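/- **Setting.** Let $F$ be a finite field with $q$ elements and $k,n\ge 1$. Matrices $G,H\in F^{k\times n}$ (thought of as generating linear codes by their rows) are in $\mathrm{PCE}$ (Permutation Code Equivalence) if $SGP=H$ for some $S\in \mathrm{GL}_k(F)$ and some permutation matrix $P\in F^{n\times n}$, and in $\mathrm{LCE}$ (Linear Code Equivalence) if $SGM=H$ for some $S\in \mathrm{GL}_k(F)$ and some monomial matrix $M\in F^{n\times n}$, that is, a matrix with exactly one non-zero entry in each row and in each column. An instance of either decision problem is a finite field, given as $\mathbb F_p[X]/(f)$ with $p$ prime and $f$ monic irreducible, together with a pair $(G,H)$ of $k\times n$ matrices over it, for some $k,n\ge1$; it is written down in the standard way, field elements being given by their $\deg f$ coefficients, in binary. **Theorem (PCE reduces to LCE).** 1. There is a deterministic Karp reduction from $\mathrm{PCE}$ to $\mathrm{LCE}$ that runs in time polynomial in $n$ and $\log q$. Precisely: there are a map that takes every instance $(G,H)$ over a field $F$ to an instance $(\widetilde G,\widetilde H)$ over the same field such that $$(G,H)\in \mathrm{PCE}\iff (\widetilde G,\widetilde H)\in \mathrm{LCE},$$ a single deterministic Turing machine that computes this map for all $F$,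 $k$, $n$, and constants $C,d$ such that the machine halts after at most $C\,(\max(k,n)\cdot\lfloor\log_2 q\rfloor)^d$ steps. In particular the bound is $C\,(n\lfloor\log_2 q\rfloor)^d$ whenever $k\le n$, which always holds for generator matrices of full row rank. If $G$ and $H$ have full row rank, then so do $\widetilde G$ and $\widetilde H$. 2. Moreover, for $A\in F^{k\times n}$ and $m\ge 1$ let $A'$ be the $(k+1)\times(n+2nm+1)$ matrix whose columns are: each column of $A$ with an entry $1$ appended at the bottom; $m$ copies of each column of $A$ with an entry $0$ appended at the bottom; and $nm+1$ copies of the last standard basis vector $e_{k+1}$. If the maximum number of times that a column occurs in the matrix is the same number $m-1$ for $G$ and for $H$, then $$(G,H)\in \mathrm{PCE}\iff (G',H')\in \mathrm{LCE}.$$ -/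

import Mathlib

open scoped Matrix Polynomial

/-! ### Code equivalence -/

/-- Exactly one nonzero entry in each row and each column, each of these being `1`. -/
def IsPermutationMatrix {F : Type*} [Field F] {ι : Type*} (P : Matrix ι ι F) : Prop :=
  (∀ i, ∃! j, P i j ≠ 0) ∧ (∀ j, ∃! i, P i j ≠ 0) ∧ ∀ i j, P i j = 0 ∨ P i j = 1

/-- Exactly one nonzero entry in each row and each column. -/
def IsMonomialMatrix {F : Type*} [Field F] {ι : Type*} (M : Matrix ι ι F) : Prop :=
  (∀ i, ∃! j, M i j ≠ 0) ∧ (∀ j, ∃! i, M i j ≠ 0)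

/-- Permutation code equivalence: `S * G * P = H` with `S` invertible and `P` a permutation
matrix. -/
def PermutationCodeEquiv {F : Type*} [Field F] {κ ι : Type*} [Fintype κ] [DecidableEq κ]
    [Fintype ι] (G H : Matrix κ ι F) : Prop :=
  ∃ (S : Matrix κ κ F) (P : Matrix ι ι F),
    IsUnit S ∧ IsPermutationMatrix P ∧ S * G * P = H

/-- Linear (monomial) code equivalence: `S * G * M = H` with `S` invertible and `M` a monomial
matrix. -/
def LinearCodeEquiv {F : Type*} [Field F] {κ ι : Type*} [Fintype κ] [DecidableEq κ]
    [Fintype ι] (G H : Matrix κ ι F) : Prop :=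
  ∃ (S : Matrix κ κ F) (M : Matrix ι ι F),
    IsUnit S ∧ IsMonomialMatrix M ∧ S * G * M = H

open scoped Classical in
/-- The maximum number of times that a column occurs in `A` (`0` if `A` has no column). -/
noncomputable def maxColumnMultiplicity {F : Type*} {k n : ℕ} (A : Matrix (Fin k) (Fin n) F) : ℕ :=
  Finset.univ.sup fun j : Fin n => (Finset.univ.filter fun j' : Fin n => A.col j' = A.col j).card

/-- With `m` copies, the matrix of size `(k + 1) × (n + n m + (n m + 1))` made of three blocks of
columns: each column of `A` over a `1`; `m` copies of each column of `A` over a `0`; and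
`n m + 1` copies of the last standard basis vector. -/
def blockExtension {F : Type*} [Field F] {k n : ℕ} (m : ℕ) (A : Matrix (Fin k) (Fin n) F) :
    Matrix (Fin k ⊕ Unit) (Fin n ⊕ (Fin n × Fin m) ⊕ Fin (n * m + 1)) F :=
  Matrix.of fun
    | .inl i, .inl j => A i j
    | .inl i, .inr (.inl jl) => A i jl.1
    | .inl _, .inr (.inr _) => 0
    | .inr _, .inl _ => 1
    | .inr _, .inr (.inl _) => 0
    | .inr _, .inr (.inr _) => 1

/-! ### Finite fields, presented for a machine -/

/-- A finite field given as `(ℤ/p)[X] / (f)`, with `p` prime and `f` monic and irreducible. -/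
structure FiniteFieldPresentation where
  p : ℕ
  prime : p.Prime
  f : (ZMod p)[X]
  monic : f.Monic
  irreducible : Irreducible f

namespace FiniteFieldPresentation

instance (K : FiniteFieldPresentation) : Fact K.p.Prime := ⟨K.prime⟩

instance (K : FiniteFieldPresentation) : Fact (Irreducible K.f) := ⟨K.irreducible⟩

/-- The field `(ℤ/p)[X] / (f)`. -/
abbrev Carrier (K : FiniteFieldPresentation) : Type := AdjoinRoot K.f

/-- The number of elements of the field. -/
def q (K : FiniteFieldPresentation) : ℕ := K.p ^ K.f.natDegree

theorem natCard_carrier (K : FiniteFieldPresentation) : Nat.card K.Carrier = K.q := by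
  have e := (AdjoinRoot.powerBasis' K.monic).basis.equivFun.toEquiv
  rw [Nat.card_congr e, Nat.card_fun]
  simp [q]

end FiniteFieldPresentation

/-! ### Instances and their encoding as strings -/

/-- An input of the problems over the field `K`: two `k × n` matrices over `K`. -/
structure CodePair (K : FiniteFieldPresentation) where
  k : ℕ
  n : ℕ
  k_pos : 0 < k
  n_pos : 0 < n
  G : Matrix (Fin k) (Fin n) K.Carrier
  H : Matrix (Fin k) (Fin n) K.Carrier

namespace CodePair

variable {K : FiniteFieldPresentation}

/-- The yes-instances of Permutation Code Equivalence. -/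
def PCE (x : CodePair K) : Prop := PermutationCodeEquiv x.G x.H

/-- The yes-instances of Linear Code Equivalence. -/
def LCE (x : CodePair K) : Prop := LinearCodeEquiv x.G x.H

/-- Both matrices have full row rank. -/
def FullRowRank (x : CodePair K) : Prop :=
  LinearIndependent K.Carrier x.G.row ∧ LinearIndependent K.Carrier x.H.row

end CodePair

open Computability in
/-- A natural number in binary, followed by a comma. -/
def encodeBinary (a : ℕ) : List Γ' := (encodeNat a).map Γ'.bit ++ [Γ'.comma]

open Computability in
/-- The prime `p` and the coefficients of `f`, from degree `0` to `deg f`, in brackets. -/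
def encodeField (K : FiniteFieldPresentation) : List Γ' :=
  Γ'.bra :: encodeBinary K.p ++
    (List.range (K.f.natDegree + 1)).flatMap (fun i => encodeBinary (K.f.coeff i).val) ++ [Γ'.ket]

open Computability in
/-- A field element, given by the `deg f` coefficients of its representative of degree less than
`deg f`, in brackets. -/
noncomputable def encodeElement (K : FiniteFieldPresentation) (a : K.Carrier) : List Γ' :=
  Γ'.bra :: (List.range K.f.natDegree).flatMap
    (fun i => encodeBinary ((AdjoinRoot.modByMonicHom K.monic a).coeff i).val) ++ [Γ'.ket]

open Computability in
/-- A matrix, as the list of its columns, each being the list of its entries, in brackets. -/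
noncomputable def encodeMatrix (K : FiniteFieldPresentation) {k n : ℕ}
    (A : Matrix (Fin k) (Fin n) K.Carrier) : List Γ' :=
  Γ'.bra :: (List.finRange n).flatMap
    (fun j => Γ'.bra :: (List.finRange k).flatMap (fun i => encodeElement K (A i j)) ++ [Γ'.ket])
    ++ [Γ'.ket]

open Computability in
/-- The whole input: the field, then the two matrices. -/
noncomputable def encodeInstance (K : FiniteFieldPresentation) (x : CodePair K) : List Γ' :=
  encodeField K ++ encodeMatrix K x.G ++ encodeMatrix K x.H

/-! ### Running time -/

open Computability in
/-- Started on the string `w`, the (deterministic, multi-stack) Turing machine `T` halts after at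
most `t` steps with output `w'`. -/
def RunsInTime (T : Turing.TM2ComputableAux Γ' Γ') (w w' : List Γ') (t : ℕ) : Prop :=
  Nonempty (Turing.TM2OutputsInTime T.tm (w.map T.inputAlphabet.symm)
    (some (w'.map T.outputAlphabet.symm)) t)

/-! ### Counting columns up to scalars -/

section Counting

/-! A monomial equivalence moves columns by a linear bijection, a permutation and individual nonzero
scalars. Hence it transports, along a linear bijection, the number of columns on each punctured line
(`LinearCodeEquiv.exists_lineCount_eq`). Permutation equivalence is the finer statement that a
linear bijection carries one column multiset to the other (`permutationCodeEquiv_iff`). The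
extension of the columns is built so that its line counts already reveal the true multiplicities of
the old columns.

Let `M`, `N` be the old column multisets, and let `Φ` match the line counts of their extensions,
with `m` above every multiplicity in `N` and `E` above `m` times the number of columns. The line of
`(0, 1)` carries at least `E` columns and every line not through `(0, 1)` carries fewer, so `Φ (0,
1) = (0, l)`. For a nonzero column `a`, the line of `(a, 0)` carries at least `m` columns, while
that of `(b, s)` with `b, s ≠ 0` carries only `N.count (s⁻¹ • b) < m`. So `Φ (a, 0) = (S a, 0)`,
whence `Φ (a, 1) = (S a, l)`. Comparing the counts on these last two lines gives `M.count a =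
N.count (l⁻¹ • S a)`: one common scalar remains, and `l⁻¹ • S` maps `M` to `N`. This is
`exists_map_eq_of_lineCount_extendColumns`; the converse extends a linear bijection by the identity
on the last coordinate.

For the block matrices, `m` is the maximal multiplicity plus one and `E = n * m + 1`. The machine
computes no multiplicity: with `L` the length of the input string it takes `m = L` and `E = 2 * L *
n`, which suffice because `n < L`. It counts the input symbols and makes one pass over each matrix
per kind of column required, each pass linear in the length of that matrix. The time is therefore
quadratic in `L`, and `L` is polynomial in `max k n * log q`. -/

open scoped Classical in
/-- The number of members of `M` that are nonzero multiples of `w`. -/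
noncomputable def lineCount (F : Type*) {W : Type*} [Field F] [AddCommGroup W] [Module F W]
    (w : W) (M : Multiset W) : ℕ :=
  M.countP fun v => ∃ c : F, c ≠ 0 ∧ v = c • w

variable {F V : Type*} [Field F] [AddCommGroup V] [Module F V]

/-- The columns of `M` over a `1`, `m` copies of the columns of `M` over a `0`, and `E` copies of
the last basis vector. -/
def extendColumns (F : Type*) {V : Type*} [Field F] [AddCommGroup V] (m E : ℕ) (M : Multiset V) :
    Multiset (V × F) :=
  M.map (fun a => (a, 1)) + m • M.map (fun a => (a, 0)) + Multiset.replicate E (0, 1)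

open scoped Classical in
theorem lineCount_extendColumns (m E : ℕ) (M : Multiset V) (w : V × F) :
    lineCount F w (extendColumns F m E M) =
      M.countP (fun a => ∃ c : F, c ≠ 0 ∧ (a, (1 : F)) = c • w) +
        m * M.countP (fun a => ∃ c : F, c ≠ 0 ∧ (a, (0 : F)) = c • w) +
        if ∃ c : F, c ≠ 0 ∧ ((0 : V), (1 : F)) = c • w then E else 0 := by
  unfold lineCount extendColumns
  rw [Multiset.countP_add, Multiset.countP_add, Multiset.countP_nsmul, Multiset.countP_map,
    Multiset.countP_map, ← Multiset.countP_eq_card_filter, ← Multiset.countP_eq_card_filter]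
  congr 1
  split_ifs with h
  · rw [Multiset.countP_eq_card.2, Multiset.card_replicate]
    intro a ha
    rw [Multiset.eq_of_mem_replicate ha]; exact h
  · rw [Multiset.countP_eq_zero]
    intro a ha
    rw [Multiset.eq_of_mem_replicate ha]; exact h

-- The last coordinate normalises the scalar: the only vector of height one on this line is `(s⁻¹ •
-- a, 1)`. True multiplicities, not multiplicities up to scalars, thus become visible.
open scoped Classical in
theorem lineCount_extendColumns_affine (m E : ℕ) (M : Multiset V) {a : V} {s : F} (ha : a ≠ 0)
    (hs : s ≠ 0) : lineCount F (a, s) (extendColumns F m E M) = M.count (s⁻¹ • a) := by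
  rw [lineCount_extendColumns, (Multiset.countP_eq_zero (p := fun v => ∃ c : F, c ≠ 0 ∧
    (v, (0 : F)) = c • (a, s))).2, if_neg, Multiset.count]
  · simp only [mul_zero, add_zero]
    refine Multiset.countP_congr rfl fun v _ => ?_
    simp only [Prod.smul_mk, Prod.mk.injEq, smul_eq_mul, eq_iff_iff]
    constructor
    · rintro ⟨c, -, rfl, h⟩
      rw [eq_inv_of_mul_eq_one_left h.symm]
    · rintro rfl
      exact ⟨s⁻¹, inv_ne_zero hs, rfl, (inv_mul_cancel₀ hs).symm⟩
  · rintro ⟨c, hc, h⟩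
    simp only [Prod.smul_mk, Prod.mk.injEq] at h
    exact smul_ne_zero hc ha h.1.symm
  · rintro v - ⟨c, hc, h⟩
    simp only [Prod.smul_mk, Prod.mk.injEq, smul_eq_mul] at h
    exact mul_ne_zero hc hs h.2.symm

theorem lineCount_extendColumns_linear (m E : ℕ) (M : Multiset V) (a : V) :
    lineCount F (a, 0) (extendColumns F m E M) = m * lineCount F a M := by
  classical
  rw [lineCount_extendColumns, (Multiset.countP_eq_zero (p := fun v => ∃ c : F, c ≠ 0 ∧
    (v, (1 : F)) = c • (a, (0 : F)))).2, if_neg, zero_add, add_zero, lineCount]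
  · simp
  · rintro ⟨c, hc, h⟩
    simp at h
  · rintro v - ⟨c, hc, h⟩
    simp at h

-- Zero columns over a `1` coincide with the added copies of `(0, 1)`.
open scoped Classical in
theorem lineCount_extendColumns_last (m E : ℕ) (M : Multiset V) {s : F} (hs : s ≠ 0) :
    lineCount F ((0 : V), s) (extendColumns F m E M) = M.count 0 + E := by
  rw [lineCount_extendColumns, (Multiset.countP_eq_zero (p := fun v => ∃ c : F, c ≠ 0 ∧
    (v, (0 : F)) = c • ((0 : V), s))).2, if_pos, mul_zero, add_zero, Multiset.count]
  · congr 1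
    refine Multiset.countP_congr rfl fun v _ => ?_
    simp only [Prod.smul_mk, Prod.mk.injEq, smul_eq_mul, eq_iff_iff, smul_zero]
    constructor
    · rintro ⟨c, -, rfl, h⟩
      rfl
    · rintro rfl
      exact ⟨s⁻¹, inv_ne_zero hs, rfl, (inv_mul_cancel₀ hs).symm⟩
  · exact ⟨s⁻¹, inv_ne_zero hs, by simp [inv_mul_cancel₀ hs]⟩
  · rintro v - ⟨c, hc, h⟩
    simp only [Prod.smul_mk, Prod.mk.injEq, smul_eq_mul] at h
    exact mul_ne_zero hc hs h.2.symm

/-- A linear equivalence that fixes the line of `(0, 1)` induces one on the first factor. -/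
theorem exists_linearEquiv_fst (Φ : (V × F) ≃ₗ[F] (V × F)) {l : F} (hl : l ≠ 0)
    (h : Φ (0, 1) = (0, l)) : ∃ S : V ≃ₗ[F] V, ∀ a, S a = (Φ (a, 0)).1 := by
  have key : ∀ s : F, Φ (0, s) = (0, s * l) := fun s => by
    have : ((0 : V), s) = s • ((0 : V), (1 : F)) := by simp
    rw [this, map_smul, h]; simp
  refine ⟨LinearEquiv.ofBijective (LinearMap.fst F V F ∘ₗ Φ.toLinearMap ∘ₗ LinearMap.inl F V F)
    ⟨?_, ?_⟩, fun a => rfl⟩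
  · rw [← LinearMap.ker_eq_bot, LinearMap.ker_eq_bot']
    intro a ha
    -- A vector with zero first component lies on the line of `(0, 1)`, which is already the image
    -- of that line.
    have h1 : Φ (a, 0) = Φ (0, (Φ (a, 0)).2 * l⁻¹) := by
      rw [key, inv_mul_cancel_right₀ hl]
      exact Prod.ext ha rfl
    exact congrArg Prod.fst (Φ.injective h1)
  · intro b
    obtain ⟨⟨a, s⟩, hs⟩ := Φ.surjective (b, 0)
    refine ⟨a, ?_⟩
    have h2 : ((a, s) : V × F) = (a, 0) + (0, s) := by simp
    rw [h2, map_add, key] at hs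
    simpa using congrArg Prod.fst hs

/-- The two thresholds separate the three kinds of lines: `E` singles out the line of `(0, 1)`, and
`m` separates the lines of columns `(a, 0)` from those of nonzero vectors over a nonzero scalar. -/
theorem exists_map_eq_of_lineCount_extendColumns {m E : ℕ} {M N : Multiset V}
    (hcard : M.card = N.card) (hm : ∀ v, ∀ [DecidableEq V], N.count v < m) (hE : M.card * m < E)
    (Φ : (V × F) ≃ₗ[F] (V × F))
    (h : ∀ w, lineCount F w (extendColumns F m E M) =
      lineCount F (Φ w) (extendColumns F m E N)) :
    ∃ S : V ≃ₗ[F] V, M.map S = N := by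
  classical
  have m0 : 0 < m := (Nat.zero_le _).trans_lt (hm 0)
  have hΦ : ∃ l : F, l ≠ 0 ∧ Φ (0, 1) = (0, l) := by
    rcases hw : Φ (0, 1) with ⟨v, s⟩
    have h0 := h (0, 1)
    rw [hw, lineCount_extendColumns_last _ _ _ one_ne_zero] at h0
    rcases eq_or_ne v 0 with rfl | hv
    · refine ⟨s, ?_, rfl⟩
      rintro rfl
      have := (map_eq_zero_iff Φ Φ.injective).1 hw
      simp at this
    · exfalso
      have hle : lineCount F (v, s) (extendColumns F m E N) ≤ M.card * m := by
        rcases eq_or_ne s 0 with rfl | hs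
        · rw [lineCount_extendColumns_linear, mul_comm, hcard]
          exact Nat.mul_le_mul_right _ (by unfold lineCount; exact Multiset.countP_le_card _ _)
        · rw [lineCount_extendColumns_affine _ _ _ hv hs, hcard]
          exact (Multiset.count_le_card _ _).trans (Nat.le_mul_of_pos_right _ m0)
      omega
  obtain ⟨l, hl, hΦ⟩ := hΦ
  obtain ⟨S, hS⟩ := exists_linearEquiv_fst Φ hl hΦ
  have hsnd : ∀ a ∈ M, (Φ (a, 0)).2 = 0 := by
    intro a ha
    by_contra hr
    rcases eq_or_ne a 0 with rfl | ha0
    · simp [show ((0 : V), (0 : F)) = 0 from rfl] at hr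
    have h1 := h (a, 0)
    rw [lineCount_extendColumns_linear, ← Prod.mk.eta (p := Φ (a, 0)), ← hS,
      lineCount_extendColumns_affine _ _ _ (S.map_ne_zero_iff.2 ha0) hr] at h1
    have h2 : 0 < lineCount F a M :=
      Multiset.countP_pos.2 ⟨a, ha, 1, one_ne_zero, (one_smul _ _).symm⟩
    have h3 := hm ((Φ (a, 0)).2⁻¹ • S a)
    have h4 := Nat.le_mul_of_pos_right m h2
    omega
  refine ⟨S.trans (LinearEquiv.smulOfNeZero F V l⁻¹ (inv_ne_zero hl)), ?_⟩
  -- Since the cardinalities agree, one inequality between multiplicities suffices, and it needs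
  -- checking only at images of members of `M`, where `hsnd` applies.
  refine Multiset.eq_of_le_of_card_le ?_ (by simp [hcard])
  rw [Multiset.le_iff_count]
  intro b
  set T : V ≃ₗ[F] V := S.trans (LinearEquiv.smulOfNeZero F V l⁻¹ (inv_ne_zero hl)) with hT
  obtain ⟨a, rfl⟩ := T.surjective b
  rw [Multiset.count_map_eq_count' _ _ T.injective]
  by_cases ha : a ∈ M
  swap
  · simp [Multiset.count_eq_zero_of_notMem ha]
  rcases eq_or_ne a 0 with rfl | ha0
  -- The zero column is invisible on the lines used below; its multiplicity is read off the line of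
  -- `(0, 1)` after cancelling `E`.
  · have h1 := h (0, 1)
    rw [hΦ, lineCount_extendColumns_last _ _ _ one_ne_zero,
      lineCount_extendColumns_last _ _ _ hl] at h1
    rw [map_zero]; omega
  · have h1 := h (a, 1)
    have h2 : Φ (a, 1) = (S a, l) := by
      have : ((a, 1) : V × F) = (a, 0) + (0, 1) := by simp
      rw [this, map_add, hΦ, ← Prod.mk.eta (p := Φ (a, 0)), ← hS, hsnd a ha]
      simp
    rw [h2, lineCount_extendColumns_affine _ _ _ ha0 one_ne_zero,
      lineCount_extendColumns_affine _ _ _ (S.map_ne_zero_iff.2 ha0) hl, inv_one, one_smul] at h1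
    exact h1.le

theorem map_extendColumns (m E : ℕ) (M : Multiset V) (S : V ≃ₗ[F] V) :
    (extendColumns F m E M).map (S.prodCongr (LinearEquiv.refl F F)) =
      extendColumns F m E (M.map S) := by
  simp [extendColumns, Multiset.map_nsmul, Multiset.map_map, Function.comp_def]

/-- Equal multisets of values mean fibres of equal size; bijections between the fibres glue to a
permutation. -/
theorem exists_perm_of_map_univ_eq {ι W : Type*} [Fintype ι] {f g : ι → W}
    (h : Finset.univ.val.map f = Finset.univ.val.map g) : ∃ σ : Equiv.Perm ι, ∀ j, g j = f (σ j) := by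
  classical
  have hc : ∀ b, Nonempty ({i // g i = b} ≃ {i // f i = b}) := fun b => by
    refine ⟨Fintype.equivOfCardEq ?_⟩
    have := congrArg (Multiset.count b) h
    rw [Multiset.count_map, Multiset.count_map] at this
    rw [Fintype.card_subtype, Fintype.card_subtype, Finset.card_def, Finset.card_def,
      Finset.filter_val, Finset.filter_val]
    simpa only [eq_comm] using this.symm
  exact ⟨Equiv.ofFiberEquiv fun b => (hc b).some, fun j => (Equiv.ofFiberEquiv_map _ j).symm⟩

end Counting

/-! ### Code equivalence in terms of columns -/

section Columns

variable {F : Type*} [Field F] {κ ι : Type*}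

/-- The columns of a matrix, with multiplicities. -/
def columns [Fintype ι] (A : Matrix κ ι F) : Multiset (κ → F) := Finset.univ.val.map A.col

theorem IsMonomialMatrix.exists_perm [Finite ι] [DecidableEq ι] {M : Matrix ι ι F}
    (h : IsMonomialMatrix M) : ∃ (σ : Equiv.Perm ι) (c : ι → F), (∀ j, c j ≠ 0) ∧
      ∀ i j, M i j = if i = σ j then c j else 0 := by
  choose s hs hs' using h.2
  have inj : Function.Injective s := fun j j' hj => (h.1 (s j)).unique (hs j) (hj ▸ hs j')
  refine ⟨Equiv.ofBijective s (Finite.injective_iff_bijective.1 inj), fun j => M (s j) j, hs,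
    fun i j => ?_⟩
  split_ifs with hi
  · rw [hi]; rfl
  · by_contra hne
    exact hi (hs' j i hne)

theorem IsPermutationMatrix.exists_perm [Finite ι] [DecidableEq ι] {M : Matrix ι ι F}
    (h : IsPermutationMatrix M) : ∃ σ : Equiv.Perm ι, ∀ i j, M i j = if i = σ j then 1 else 0 := by
  obtain ⟨σ, c, hc, hM⟩ := IsMonomialMatrix.exists_perm ⟨h.1, h.2.1⟩
  refine ⟨σ, fun i j => ?_⟩
  rw [hM i j]
  have h1 := h.2.2 (σ j) j
  rw [hM, if_pos rfl] at h1
  rw [h1.resolve_left (hc j)]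

theorem isPermutationMatrix_of_perm [DecidableEq ι] (σ : Equiv.Perm ι) :
    IsPermutationMatrix (Matrix.of fun i j => if i = σ j then (1 : F) else 0) := by
  refine ⟨fun i => ⟨σ.symm i, by simp, fun j hj => ?_⟩, fun j => ⟨σ j, by simp, fun i hi => ?_⟩,
    fun i j => ?_⟩
  · by_contra hne
    exact hj (if_neg fun h => hne (by rw [h, Equiv.symm_apply_apply]))
  · by_contra hne
    exact hi (if_neg hne)
  · rw [Matrix.of_apply]; split_ifs <;> simp

variable [Fintype κ] [DecidableEq κ] [Fintype ι]

omit [DecidableEq κ] in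
theorem col_mul_mul_of_perm [DecidableEq ι] (S : Matrix κ κ F) (G : Matrix κ ι F)
    {M : Matrix ι ι F} {σ : Equiv.Perm ι} {c : ι → F}
    (hM : ∀ i j, M i j = if i = σ j then c j else 0) (j : ι) :
    (S * G * M).col j = c j • S.mulVec (G.col (σ j)) := by
  ext i
  simp only [Matrix.col_apply, Matrix.mul_apply (M := S * G), hM, mul_ite, mul_zero,
    Finset.sum_ite_eq', Finset.mem_univ, if_true, Pi.smul_apply, smul_eq_mul]
  rw [mul_comm]; rfl

theorem PermutationCodeEquiv.linearCodeEquiv {G H : Matrix κ ι F}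
    (h : PermutationCodeEquiv G H) : LinearCodeEquiv G H :=
  let ⟨S, P, hS, hP, e⟩ := h
  ⟨S, P, hS, ⟨hP.1, hP.2.1⟩, e⟩

theorem IsUnit.exists_linearEquiv {S : Matrix κ κ F} (hS : IsUnit S) :
    ∃ T : (κ → F) ≃ₗ[F] (κ → F), ∀ v, T v = S.mulVec v :=
  ⟨S.toLinearEquiv' hS.invertible, fun _ => rfl⟩

theorem permutationCodeEquiv_iff {G H : Matrix κ ι F} :
    PermutationCodeEquiv G H ↔ ∃ T : (κ → F) ≃ₗ[F] (κ → F), (columns G).map T = columns H := by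
  classical
  constructor
  · rintro ⟨S, P, hS, hP, rfl⟩
    obtain ⟨σ, hσ⟩ := hP.exists_perm
    obtain ⟨T, hT⟩ := hS.exists_linearEquiv
    refine ⟨T, ?_⟩
    rw [columns, columns, Multiset.map_map]
    conv_lhs => rw [← Multiset.map_univ_val_equiv σ, Multiset.map_map]
    refine Multiset.map_congr rfl fun j _ => ?_
    rw [col_mul_mul_of_perm S G hσ, one_smul, ← hT]; rfl
  · rintro ⟨T, hT⟩
    rw [columns, columns, Multiset.map_map] at hT
    obtain ⟨σ, hσ⟩ := exists_perm_of_map_univ_eq hT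
    refine ⟨LinearMap.toMatrix' T.toLinearMap, _, ?_, isPermutationMatrix_of_perm σ, ?_⟩
    · rw [Matrix.isUnit_iff_isUnit_det, LinearMap.det_toMatrix']
      exact T.isUnit_det'
    · refine Matrix.ext_col fun j => ?_
      rw [col_mul_mul_of_perm (c := 1) _ G (σ := σ)
        (M := Matrix.of fun i j => if i = σ j then (1 : F) else 0) (fun _ _ => rfl), Pi.one_apply, hσ,
        one_smul, LinearMap.toMatrix'_mulVec]
      rfl

/-- Column `j` of `S * G * M` is a nonzero multiple of `S` applied to column `σ j` of `G`, and the
multiple does not change its line. -/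
theorem LinearCodeEquiv.exists_lineCount_eq {G H : Matrix κ ι F} (h : LinearCodeEquiv G H) :
    ∃ T : (κ → F) ≃ₗ[F] (κ → F), ∀ w,
      lineCount F w (columns G) = lineCount F (T w) (columns H) := by
  classical
  obtain ⟨S, M, hS, hM, rfl⟩ := h
  obtain ⟨σ, c, hc, hσ⟩ := hM.exists_perm
  obtain ⟨T, hT⟩ := hS.exists_linearEquiv
  refine ⟨T, fun w => ?_⟩
  rw [lineCount, lineCount, columns, columns]
  conv_lhs => rw [← Multiset.map_univ_val_equiv σ, Multiset.map_map]
  rw [Multiset.countP_map, Multiset.countP_map]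
  congr 1
  refine Multiset.filter_congr fun j _ => ?_
  rw [col_mul_mul_of_perm S G hσ, ← hT]
  constructor
  · rintro ⟨d, hd, h⟩
    refine ⟨c j * d, mul_ne_zero (hc j) hd, ?_⟩
    rw [mul_smul, ← map_smul T d w, ← h]; rfl
  · rintro ⟨d, hd, h⟩
    refine ⟨(c j)⁻¹ * d, mul_ne_zero (inv_ne_zero (hc j)) hd, T.injective ?_⟩
    rw [map_smul, mul_smul, ← h, inv_smul_smul₀ (hc j)]; rfl

theorem lineCount_map {V W : Type*} [AddCommGroup V] [Module F V] [AddCommGroup W] [Module F W]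
    (e : V ≃ₗ[F] W) (w : W) (M : Multiset V) :
    lineCount F w (M.map e) = lineCount F (e.symm w) M := by
  classical
  rw [lineCount, lineCount, Multiset.countP_map, ← Multiset.countP_eq_card_filter]
  refine Multiset.countP_congr rfl fun v _ => propext ?_
  refine exists_congr fun c => and_congr_right fun _ => ?_
  rw [← LinearEquiv.eq_symm_apply, map_smul]

/-- If the columns of `G'` and `H'` are, up to a linear change of coordinates, those of `G` and `H`
extended as in `extendColumns`, then `G` and `H` are permutation equivalent if and only if `G'` and
`H'` are linearly equivalent. -/
theorem permutationCodeEquiv_iff_linearCodeEquiv {κ' ι' : Type*} [Fintype κ'] [DecidableEq κ']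
    [Fintype ι'] {G H : Matrix κ ι F} {G' H' : Matrix κ' ι' F} {m E : ℕ}
    (e : (κ' → F) ≃ₗ[F] (κ → F) × F)
    (hG : (columns G').map e = extendColumns F m E (columns G))
    (hH : (columns H').map e = extendColumns F m E (columns H))
    (hm : ∀ v, ∀ [DecidableEq (κ → F)], (columns H).count v < m) (hE : Fintype.card ι * m < E) :
    PermutationCodeEquiv G H ↔ LinearCodeEquiv G' H' := by
  constructor
  · rw [permutationCodeEquiv_iff]
    rintro ⟨T, hT⟩
    refine PermutationCodeEquiv.linearCodeEquiv (permutationCodeEquiv_iff.2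
      ⟨(e.trans (T.prodCongr (LinearEquiv.refl F F))).trans e.symm, ?_⟩)
    refine Multiset.map_injective e.injective ?_
    rw [hH, ← hT, ← map_extendColumns, ← hG, Multiset.map_map, Multiset.map_map]
    refine Multiset.map_congr rfl fun v _ => ?_
    simp
  · intro h
    obtain ⟨T, hT⟩ := h.exists_lineCount_eq
    rw [permutationCodeEquiv_iff]
    refine exists_map_eq_of_lineCount_extendColumns (m := m) (E := E) (by simp [columns]) hm
      (by simpa [columns] using hE) ((e.symm.trans T).trans e) fun w => ?_
    rw [← hG, ← hH, lineCount_map, lineCount_map, hT]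
    simp

/-! ### The columns of the block matrix -/

theorem map_univ_val_sum {α β γ : Type*} [Fintype α] [Fintype β] (f : α ⊕ β → γ) :
    Finset.univ.val.map f =
      Finset.univ.val.map (fun a => f (.inl a)) + Finset.univ.val.map (fun b => f (.inr b)) := by
  rw [← Finset.univ_disjSum_univ, Finset.val_disjSum, Multiset.disjSum, Multiset.map_add,
    Multiset.map_map, Multiset.map_map]
  rfl

theorem map_univ_val_prod_fst {α β γ : Type*} [Fintype α] [Fintype β] (f : α → γ) :
    (Finset.univ : Finset (α × β)).val.map (fun x => f x.1) =
      Fintype.card β • Finset.univ.val.map f := by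
  classical
  ext c
  rw [Multiset.count_nsmul, Multiset.count_map, Multiset.count_map, ← Finset.filter_val,
    ← Finset.filter_val, ← Finset.card_def, ← Finset.card_def]
  have : (Finset.univ.filter fun x : α × β => c = f x.1) =
      (Finset.univ.filter fun a => c = f a) ×ˢ Finset.univ := by
    ext; simp
  rw [this, Finset.card_product, Finset.card_univ, mul_comm]

omit [Field F] in
theorem count_columns_le_maxColumnMultiplicity {k n : ℕ} (A : Matrix (Fin k) (Fin n) F)
    [DecidableEq (Fin k → F)] (v : Fin k → F) :
    (columns A).count v ≤ maxColumnMultiplicity A := by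
  rcases Nat.eq_zero_or_pos ((columns A).count v) with h | h
  · exact h.trans_le (Nat.zero_le _)
  obtain ⟨j, -, rfl⟩ := Multiset.mem_map.1 (Multiset.count_pos.1 h)
  rw [columns, Multiset.count_map, ← Finset.filter_val, ← Finset.card_def]
  unfold maxColumnMultiplicity
  refine (le_of_eq ?_).trans (Finset.le_sup (Finset.mem_univ j))
  refine congrArg Finset.card (Finset.ext fun i => ?_)
  simp only [Finset.mem_filter, eq_comm]

/-- Splitting off the last coordinate. -/
def sumUnitEquiv (F κ : Type*) [Field F] : (κ ⊕ Unit → F) ≃ₗ[F] (κ → F) × F :=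
  (LinearEquiv.sumArrowLequivProdArrow κ Unit F F).trans
    ((LinearEquiv.refl F (κ → F)).prodCongr (LinearEquiv.funUnique Unit F F))

theorem map_columns_blockExtension {k n : ℕ} (m : ℕ) (A : Matrix (Fin k) (Fin n) F) :
    (columns (blockExtension m A)).map (sumUnitEquiv F (Fin k)) =
      extendColumns F m (n * m + 1) (columns A) := by
  rw [columns, Multiset.map_map, map_univ_val_sum, map_univ_val_sum, extendColumns, columns,
    Multiset.map_map, Multiset.map_map, add_assoc]
  refine congr_arg₂ _ rfl (congr_arg₂ _ ?_ ?_)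
  · exact (map_univ_val_prod_fst (fun j => (A.col j, (0 : F)))).trans (by simp)
  · refine Multiset.eq_replicate.2 ⟨by simp, fun b hb => ?_⟩
    obtain ⟨j, -, rfl⟩ := Multiset.mem_map.1 hb
    rfl

theorem permutationCodeEquiv_iff_blockExtension {k n m : ℕ} (G H : Matrix (Fin k) (Fin n) F)
    (hm : m = maxColumnMultiplicity H + 1) :
    PermutationCodeEquiv G H ↔ LinearCodeEquiv (blockExtension m G) (blockExtension m H) :=
  permutationCodeEquiv_iff_linearCodeEquiv (sumUnitEquiv F (Fin k))
    (map_columns_blockExtension m G) (map_columns_blockExtension m H)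
    (fun v _ => hm ▸ Nat.lt_succ_of_le (count_columns_le_maxColumnMultiplicity H v)) (by simp)

end Columns

/-! ### A machine that extends the columns of two matrices -/

section Machine

open Computability

/-- The kinds of columns in `extendColumns`: a column over a `1`, a column over a `0`, and the last
basis vector. -/
inductive ColumnKind
  | affine
  | linear
  | apex
  deriving DecidableEq

instance : Fintype ColumnKind where
  elems := {.affine, .linear, .apex}
  complete κ := by cases κ <;> simp

/-- The stacks. The stacks `left` and `right` serve as a tape; the counters tell which passes over
the second matrix (`true`) and over the first matrix (`false`) remain to be done. -/
inductive Stack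
  | input
  | output
  | left
  | right
  | counter (b : Bool)
  deriving DecidableEq, Fintype

/-- The labels of the program. -/
inductive Label
  | load
  | start (b : Bool) (κ : ColumnKind)
  | column (b : Bool) (κ : ColumnKind)
  | newEntry (b : Bool) (κ : ColumnKind)
  | newBody (b : Bool) (κ : ColumnKind)
  | back (b : Bool) (κ : ColumnKind)
  | entry (b : Bool) (κ : ColumnKind)
  | body (b : Bool) (κ : ColumnKind)
  | check (b : Bool)
  | rewind (b : Bool) (κ : ColumnKind)
  | clear (b : Bool)
  | finish
  deriving DecidableEq, Fintype

/-- The kind of column that a symbol on a counter asks for. -/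
def kindOf : Γ' → ColumnKind
  | .comma => .linear
  | _ => .apex

/-- The last entry of a column of this kind, written in binary. -/
def ColumnKind.bits : ColumnKind → List Γ'
  | .linear => []
  | _ => [.bit true]

/-- The symbols within an entry that are kept in a column of this kind. -/
def ColumnKind.keep : ColumnKind → Γ' → Bool
  | .apex, s => s = .comma
  | _, _ => true

/-- The stack that is read at a label. -/
def Label.source : Label → Stack
  | .load => .input
  | .back _ _ | .rewind _ _ | .clear _ => .left
  | .check b => .counter b
  | _ => .right

/-- The symbols that are pushed and the next label, given a label and the symbol that was read. -/
def Label.action : Label → Option Γ' → List (Stack × Γ') × Option Label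
  | .load, some s =>
    -- Each input symbol orders, for each matrix, one pass of linear columns (the comma) and two of
    -- apex columns (the blanks). Loading also reverses the input, so reading runs from right to
    -- left; pushing the output then restores the order.
    ([true, false].flatMap (fun b =>
      [(.counter b, .blank), (.counter b, .blank), (.counter b, .comma)]) ++ [(.right, s)],
      some .load)
  | .load, none => ([], some (.start true .affine))
  | .start b κ, some s =>
    -- The affine pass comes first, so it alone writes the closing bracket of the new matrix.
    ((.left, s) :: (if κ = .affine then [(.output, .ket)] else []), some (.column b κ))
  | .column b κ, some .ket => ([(.left, .ket), (.output, .ket)], some (.newEntry b κ))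
  | .column b _, some .bra => ([(.left, .bra)], some (.check b))
  | .newEntry b κ, some .ket => ([(.left, .ket), (.output, .ket)], some (.newBody b κ))
  | .newBody b κ, some .bra =>
    ((.left, .bra) :: (κ.bits ++ [Γ'.bra]).map (Prod.mk Stack.output), some (.back b κ))
  | .newBody b κ, some s =>
    ((.left, s) :: (if s = .comma then [(.output, s)] else []), some (.newBody b κ))
  -- The last entry is read twice: once as a template for the new entry, then, after this return, as
  -- an old entry.
  | .back b κ, some s => ([(.right, s)], some (if s = .ket then .entry b κ else .back b κ))
  | .entry b κ, some .ket => ([(.left, .ket), (.output, .ket)], some (.body b κ))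
  | .entry b κ, some .bra => ([(.left, .bra), (.output, .bra)], some (.column b κ))
  | .body b κ, some .bra => ([(.left, .bra), (.output, .bra)], some (.entry b κ))
  | .body b κ, some s =>
    ((.left, s) :: (if κ.keep s then [(.output, s)] else []), some (.body b κ))
  | .check b, some s => ([], some (.rewind b (kindOf s)))
  | .check b, none => ([(.output, .bra)], some (.clear b))
  | .rewind b κ, some s => ([(.right, s)], some (.rewind b κ))
  | .rewind b κ, none => ([], some (.start b κ))
  | .clear b, some _ => ([], some (.clear b))
  | .clear b, none => ([], some (if b then .start false .affine else .finish))
  | .finish, some s => ([(.output, s)], some .finish)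
  | _, _ => ([], none)

/-- The statements of the machine. -/
abbrev Statement : Type := Turing.TM2.Stmt (fun _ : Stack => Γ') Label (Option Γ')

/-- The configurations of the machine. -/
abbrev Config : Type := Turing.TM2.Cfg (fun _ : Stack => Γ') Label (Option Γ')

/-- Case distinction on the symbol in the internal state. -/
def caseSymbol (f : Option Γ' → Statement) : Statement :=
  [none, some .blank, some (.bit false), some (.bit true), some .bra, some .ket,
    some .comma].foldr (fun v p => .branch (fun s => decide (s = v)) (f v) p) .halt

/-- Push some symbols, reset the internal state and go to a label, or halt. -/
def pushAndGo : List (Stack × Γ') → Option Label → Statement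
  | (k, a) :: l, next => .push k (fun _ => a) (pushAndGo l next)
  | [], some l => .load (fun _ => none) (.goto fun _ => l)
  | [], none => .load (fun _ => none) .halt

/-- The program of the machine. -/
def program (l : Label) : Statement :=
  .pop l.source (fun _ s => s) (caseSymbol fun v => pushAndGo (l.action v).1 (l.action v).2)

/-- One step of the machine. -/
abbrev machineStep : Config → Option Config := Turing.TM2.step program

/-- The machine. -/
def extensionMachine : Turing.FinTM2 where
  K := Stack
  k₀ := .input
  k₁ := .output
  Γ _ := Γ'
  Λ := Label
  main := .load
  σ := Option Γ'
  initialState := none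
  m := program

/-! ### The effect of single steps -/

/-- Push symbols on the stacks, one after the other. -/
def pushAll (S : Stack → List Γ') (l : List (Stack × Γ')) : Stack → List Γ' :=
  l.foldl (fun S x => Function.update S x.1 (x.2 :: S x.1)) S

theorem stepAux_caseSymbol (f : Option Γ' → Statement) (v : Option Γ') (S : Stack → List Γ') :
    Turing.TM2.stepAux (caseSymbol f) v S = Turing.TM2.stepAux (f v) v S := by
  rcases v with _ | (_ | (_ | _) | _ | _ | _) <;> rfl

theorem stepAux_pushAndGo (l : List (Stack × Γ')) (next : Option Label) (v : Option Γ')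
    (S : Stack → List Γ') :
    Turing.TM2.stepAux (pushAndGo l next) v S = ⟨next, none, pushAll S l⟩ := by
  induction l generalizing S with
  | nil => cases next <;> rfl
  | cons x l ih => exact ih _

theorem machineStep_mk (l : Label) (S : Stack → List Γ') :
    machineStep (⟨some l, none, S⟩ : Config) =
      some (⟨(l.action (S l.source).head?).2, none,
        pushAll (Function.update S l.source (S l.source).tail)
          (l.action (S l.source).head?).1⟩ : Config) := by
  refine congrArg some ?_
  rw [program, Turing.TM2.stepAux, stepAux_caseSymbol, stepAux_pushAndGo]

/-- The stacks with the given contents. -/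
def contents (i o l r : List Γ') (c : Bool → List Γ') : Stack → List Γ'
  | .input => i
  | .output => o
  | .left => l
  | .right => r
  | .counter b => c b

section Update

variable (i o l r x : List Γ') (c : Bool → List Γ') (b : Bool)

theorem update_contents_input :
    Function.update (contents i o l r c) .input x = contents x o l r c := by
  funext k; cases k <;> rfl

theorem update_contents_output :
    Function.update (contents i o l r c) .output x = contents i x l r c := by
  funext k; cases k <;> rfl

theorem update_contents_left :
    Function.update (contents i o l r c) .left x = contents i o x r c := by
  funext k; cases k <;> rfl

theorem update_contents_right :
    Function.update (contents i o l r c) .right x = contents i o l x c := by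
  funext k; cases k <;> rfl

theorem update_contents_counter :
    Function.update (contents i o l r c) (.counter b) x = contents i o l r (Function.update c b x) := by
  funext k
  cases k with
  | counter b' => by_cases h : b' = b <;> simp [contents, h]
  | _ => rfl

end Update

/-- The configuration with a given label and given stack contents. -/
def config (a : Option Label) (i o l r : List Γ') (c : Bool → List Γ') : Config :=
  ⟨a, none, contents i o l r c⟩

/-- The machine gets from one configuration to another one in at most `t` steps. -/
def Within (t : ℕ) (x y : Config) : Prop :=
  ∃ n ≤ t, (flip bind machineStep)^[n] (some x) = some y

theorem Within.refl (x : Config) : Within 0 x x := ⟨0, le_rfl, rfl⟩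

theorem Within.trans {s t u : ℕ} {x y z : Config} (h₁ : Within s x y) (h₂ : Within t y z)
    (hu : s + t ≤ u) : Within u x z := by
  obtain ⟨n, hn, h₁⟩ := h₁
  obtain ⟨m, hm, h₂⟩ := h₂
  refine ⟨m + n, by omega, ?_⟩
  rw [Function.iterate_add_apply, h₁, h₂]

theorem Within.mono {s t : ℕ} {x y : Config} (h : Within s x y) (hst : s ≤ t) : Within t x y :=
  h.trans (.refl _) hst

theorem Within.of_step {x y : Config} (h : machineStep x = some y) : Within 1 x y :=
  ⟨1, le_rfl, h⟩

theorem Within.head {t : ℕ} {x y z : Config} (h : machineStep x = some y)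
    (h' : Within t y z) : Within (t + 1) x z :=
  (Within.of_step h).trans h' (by omega)

theorem step_config (a : Label) (i o l r : List Γ') (c : Bool → List Γ') :
    machineStep (config (some a) i o l r c) =
      some (⟨(a.action (contents i o l r c a.source).head?).2, none,
        pushAll (Function.update (contents i o l r c) a.source (contents i o l r c a.source).tail)
          (a.action (contents i o l r c a.source).head?).1⟩ : Config) :=
  machineStep_mk _ _

section Steps

variable (i o l r : List Γ') (c : Bool → List Γ') (b : Bool) (κ : ColumnKind) (s : Γ')

theorem step_load_cons : machineStep (config (some .load) (s :: i) o l r c) =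
    some (config (some .load) i o l (s :: r) fun b => .comma :: .blank :: .blank :: c b) := by
  rw [step_config]
  simp only [Label.source, Label.action, contents, List.head?_cons, List.tail_cons,
    update_contents_input, pushAll, List.flatMap_cons, List.flatMap_nil, List.cons_append,
    List.nil_append, List.foldl_cons, List.foldl_nil, update_contents_counter, update_contents_right,
    config, Option.some.injEq]
  congr 2
  funext b; cases b <;> rfl

theorem step_load_nil : machineStep (config (some .load) [] o l r c) =
    some (config (some (.start true .affine)) [] o l r c) := by
  rw [step_config]
  simp [Label.source, Label.action, contents, update_contents_input, pushAll, config]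

theorem step_start : machineStep (config (some (.start b κ)) i o l (s :: r) c) =
    some (config (some (.column b κ)) i (if κ = .affine then .ket :: o else o) (s :: l) r c) := by
  rw [step_config]
  cases κ <;> simp [Label.source, Label.action, contents, update_contents_left, update_contents_right,
    update_contents_output, pushAll, config]

theorem step_column_ket :
    machineStep (config (some (.column b κ)) i o l (.ket :: r) c) =
      some (config (some (.newEntry b κ)) i (.ket :: o) (.ket :: l) r c) := by
  rw [step_config]
  simp [Label.source, Label.action, contents, update_contents_left, update_contents_right,
    update_contents_output, pushAll, config]

theorem step_column_bra :
    machineStep (config (some (.column b κ)) i o l (.bra :: r) c) =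
      some (config (some (.check b)) i o (.bra :: l) r c) := by
  rw [step_config]
  simp [Label.source, Label.action, contents, update_contents_left, update_contents_right,
    pushAll, config]

theorem step_newEntry :
    machineStep (config (some (.newEntry b κ)) i o l (.ket :: r) c) =
      some (config (some (.newBody b κ)) i (.ket :: o) (.ket :: l) r c) := by
  rw [step_config]
  simp [Label.source, Label.action, contents, update_contents_left, update_contents_right,
    update_contents_output, pushAll, config]

theorem step_newBody_bra :
    machineStep (config (some (.newBody b κ)) i o l (.bra :: r) c) =
      some (config (some (.back b κ)) i (.bra :: κ.bits ++ o) (.bra :: l) r c) := by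
  rw [step_config]
  cases κ <;> simp [Label.source, Label.action, contents, update_contents_left, update_contents_right,
    update_contents_output, pushAll, config, ColumnKind.bits]

theorem step_newBody {s : Γ'} (hs : s ≠ .bra) :
    machineStep (config (some (.newBody b κ)) i o l (s :: r) c) =
      some (config (some (.newBody b κ)) i (if s = .comma then s :: o else o) (s :: l) r c) := by
  rw [step_config]
  cases s <;> simp [Label.source, Label.action, contents, update_contents_left, update_contents_right,
    update_contents_output, pushAll, config] at hs ⊢

theorem step_back : machineStep (config (some (.back b κ)) i o (s :: l) r c) =
    some (config (some (if s = .ket then .entry b κ else .back b κ)) i o l (s :: r) c) := by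
  rw [step_config]
  simp [Label.source, Label.action, contents, update_contents_left, update_contents_right,
    pushAll, config]

theorem step_entry_ket :
    machineStep (config (some (.entry b κ)) i o l (.ket :: r) c) =
      some (config (some (.body b κ)) i (.ket :: o) (.ket :: l) r c) := by
  rw [step_config]
  simp [Label.source, Label.action, contents, update_contents_left, update_contents_right,
    update_contents_output, pushAll, config]

theorem step_entry_bra :
    machineStep (config (some (.entry b κ)) i o l (.bra :: r) c) =
      some (config (some (.column b κ)) i (.bra :: o) (.bra :: l) r c) := by
  rw [step_config]
  simp [Label.source, Label.action, contents, update_contents_left, update_contents_right,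
    update_contents_output, pushAll, config]

theorem step_body_bra :
    machineStep (config (some (.body b κ)) i o l (.bra :: r) c) =
      some (config (some (.entry b κ)) i (.bra :: o) (.bra :: l) r c) := by
  rw [step_config]
  simp [Label.source, Label.action, contents, update_contents_left, update_contents_right,
    update_contents_output, pushAll, config]

theorem step_body {s : Γ'} (hs : s ≠ .bra) :
    machineStep (config (some (.body b κ)) i o l (s :: r) c) =
      some (config (some (.body b κ)) i (if κ.keep s then s :: o else o) (s :: l) r c) := by
  rw [step_config]
  cases hk : κ.keep s <;> cases s <;> simp [Label.source, Label.action, contents,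
    update_contents_left, update_contents_right, update_contents_output, pushAll, config, hk] at hs ⊢

theorem step_check_cons {cs : List Γ'} (h : c b = s :: cs) :
    machineStep (config (some (.check b)) i o l r c) =
      some (config (some (.rewind b (kindOf s))) i o l r (Function.update c b cs)) := by
  rw [step_config]
  simp [Label.source, Label.action, contents, update_contents_counter, pushAll, config, h]

theorem step_check_nil (h : c b = []) :
    machineStep (config (some (.check b)) i o l r c) =
      some (config (some (.clear b)) i (.bra :: o) l r c) := by
  have hc : Function.update c b [] = c := by simpa only [h] using Function.update_eq_self b c
  rw [step_config]
  simp [Label.source, Label.action, contents, update_contents_counter, update_contents_output,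
    pushAll, config, h, hc]

theorem step_rewind_cons : machineStep (config (some (.rewind b κ)) i o (s :: l) r c) =
    some (config (some (.rewind b κ)) i o l (s :: r) c) := by
  rw [step_config]
  simp [Label.source, Label.action, contents, update_contents_left, update_contents_right,
    pushAll, config]

theorem step_rewind_nil : machineStep (config (some (.rewind b κ)) i o [] r c) =
    some (config (some (.start b κ)) i o [] r c) := by
  rw [step_config]
  simp [Label.source, Label.action, contents, update_contents_left, pushAll, config]

theorem step_clear_cons : machineStep (config (some (.clear b)) i o (s :: l) r c) =
    some (config (some (.clear b)) i o l r c) := by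
  rw [step_config]
  simp [Label.source, Label.action, contents, update_contents_left, pushAll, config]

theorem step_clear_nil : machineStep (config (some (.clear b)) i o [] r c) =
    some (config (some (if b then .start false .affine else .finish)) i o [] r c) := by
  rw [step_config]
  simp [Label.source, Label.action, contents, update_contents_left, pushAll, config]

theorem step_finish_cons : machineStep (config (some .finish) i o l (s :: r) c) =
    some (config (some .finish) i (s :: o) l r c) := by
  rw [step_config]
  simp [Label.source, Label.action, contents, update_contents_right, update_contents_output, pushAll,
    config]

theorem step_finish_nil : machineStep (config (some .finish) i o l [] c) =
    some (config none i o l [] c) := by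
  rw [step_config]
  simp [Label.source, Label.action, contents, update_contents_right, pushAll, config]

end Steps

/-! ### What the machine computes -/

/-- A string in brackets. -/
def bracket (u : List Γ') : List Γ' := .bra :: u ++ [.ket]

/-- A column, given by the strings within the brackets of its entries. -/
def columnString (us : List (List Γ')) : List Γ' := bracket (us.flatMap bracket)

/-- A matrix, given by its columns. -/
def matrixString (cols : List (List (List Γ'))) : List Γ' := bracket (cols.flatMap columnString)

/-- The string of an entry of a column of the given kind, made from the string `u` of an entry. -/
def ColumnKind.oldBody (κ : ColumnKind) (u : List Γ') : List Γ' := u.filter κ.keep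

/-- The string of the last entry of a column of the given kind. Here `u` is the string of any
entry. -/
def ColumnKind.newBody (κ : ColumnKind) (u : List Γ') : List Γ' :=
  κ.bits ++ u.filter fun s => s = .comma

/-- The column of the given kind that is made from the column `us`. -/
def ColumnKind.extend (κ : ColumnKind) (us : List (List Γ')) : List (List Γ') :=
  us.map κ.oldBody ++ [κ.newBody (us.getLastD [])]

/-- No brackets occur in the string. -/
def BracketFree (u : List Γ') : Prop := .bra ∉ u ∧ .ket ∉ u

theorem BracketFree.reverse {u : List Γ'} (h : BracketFree u) : BracketFree u.reverse := by
  simpa [BracketFree] using h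

theorem length_bracket (u : List Γ') : (bracket u).length = u.length + 2 := by
  simp [bracket]

/-! ### Runs over entries, columns and matrices -/

variable {i o l r : List Γ'} {c : Bool → List Γ'} {b : Bool} {κ : ColumnKind}

theorem Within.congr {t t' : ℕ} {a a' : Option Label} {i' o' o'' l₁ r₁ l' l'' r' r'' : List Γ'}
    {c' c'' : Bool → List Γ'} (h : Within t (config a i o l r c) (config a' i' o' l' r' c'))
    (ht : t ≤ t') (ho' : o' = o'') (hl : l = l₁ := by rfl) (hr : r = r₁ := by rfl)
    (hl' : l' = l'' := by rfl) (hr' : r' = r'' := by rfl) (hc' : c' = c'' := by rfl) :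
    Within t' (config a i o l₁ r₁ c) (config a' i' o'' l'' r'' c'') := by
  subst ho' hl hr hl' hr' hc'
  exact h.mono ht

theorem within_newBody {u : List Γ'} (hu : .bra ∉ u) :
    Within (u.length + 1) (config (some (.newBody b κ)) i o l (u ++ .bra :: r) c)
      (config (some (.back b κ)) i (.bra :: κ.bits ++ ((u.filter fun s => s = .comma).reverse ++ o))
        (.bra :: (u.reverse ++ l)) r c) := by
  induction u generalizing o l with
  | nil => exact .of_step (step_newBody_bra ..)
  | cons s u ih =>
    rw [List.mem_cons, not_or] at hu
    refine .head (step_newBody _ _ _ _ _ _ _ (Ne.symm hu.1)) ?_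
    refine (ih hu.2).congr le_rfl ?_ (hl' := by simp)
    by_cases hs : s = .comma <;> simp [hs]

theorem within_back {u : List Γ'} (hu : .ket ∉ u) :
    Within (u.length + 1) (config (some (.back b κ)) i o (u ++ .ket :: l) r c)
      (config (some (.entry b κ)) i o l (.ket :: (u.reverse ++ r)) c) := by
  induction u generalizing r with
  | nil => exact .of_step (step_back ..)
  | cons s u ih =>
    rw [List.mem_cons, not_or] at hu
    have h := step_back i o (u ++ .ket :: l) r c b κ s
    rw [if_neg (Ne.symm hu.1)] at h
    refine .head h ?_
    simpa using ih hu.2 (r := s :: r)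

theorem within_newEntry {u : List Γ'} (hu : BracketFree u) :
    Within (2 * u.length + 4) (config (some (.newEntry b κ)) i o l ((bracket u).reverse ++ r) c)
      (config (some (.entry b κ)) i (bracket (κ.newBody u) ++ o) l ((bracket u).reverse ++ r)
        c) := by
  have h1 := (Within.head (step_newEntry i o l (u.reverse ++ .bra :: r) c b κ)
    (within_newBody hu.reverse.1)).congr (r₁ := (bracket u).reverse ++ r)
    (t' := u.length + 2) (o'' := bracket (κ.newBody u) ++ o) (l'' := .bra :: u ++ .ket :: l)
    (by simp) (by simp [bracket, ColumnKind.newBody]) (hr := by simp [bracket]) (hl' := by simp)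
  refine h1.trans ((within_back (u := .bra :: u) (by simpa using hu.2)).congr
    (r'' := (bracket u).reverse ++ r) (t' := u.length + 2) (by simp) rfl (hr' := by simp [bracket])) (by omega)

theorem within_body {u : List Γ'} (hu : .bra ∉ u) :
    Within (u.length + 1) (config (some (.body b κ)) i o l (u ++ .bra :: r) c)
      (config (some (.entry b κ)) i (.bra :: ((u.filter κ.keep).reverse ++ o))
        (.bra :: (u.reverse ++ l)) r c) := by
  induction u generalizing o l with
  | nil => exact .of_step (step_body_bra ..)
  | cons s u ih =>
    rw [List.mem_cons, not_or] at hu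
    refine .head (step_body _ _ _ _ _ _ _ (Ne.symm hu.1)) ?_
    refine (ih hu.2).congr le_rfl ?_ (hl' := by simp)
    cases hs : κ.keep s <;> simp [hs]

theorem within_entry {u : List Γ'} (hu : BracketFree u) :
    Within (bracket u).length (config (some (.entry b κ)) i o l ((bracket u).reverse ++ r) c)
      (config (some (.entry b κ)) i (bracket (κ.oldBody u) ++ o) (bracket u ++ l) r c) := by
  exact (Within.head (step_entry_ket i o l (u.reverse ++ .bra :: r) c b κ)
    (within_body hu.reverse.1)).congr (by simp [bracket])
    (by simp [bracket, ColumnKind.oldBody]) (hr := by simp [bracket]) (hl' := by simp [bracket])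

theorem within_entries {us : List (List Γ')} (hus : ∀ u ∈ us, BracketFree u) :
    Within ((us.flatMap bracket).length + 1)
      (config (some (.entry b κ)) i o l ((us.flatMap bracket).reverse ++ .bra :: r) c)
      (config (some (.column b κ)) i (.bra :: ((us.map κ.oldBody).flatMap bracket ++ o))
        (.bra :: (us.flatMap bracket ++ l)) r c) := by
  induction us using List.reverseRecOn generalizing o l with
  | nil => exact .of_step (step_entry_bra ..)
  | append_singleton us u ih =>
    have h1 := within_entry (i := i) (o := o) (l := l)
      (r := (us.flatMap bracket).reverse ++ .bra :: r) (c := c) (b := b) (κ := κ)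
      (hus u (by simp))
    refine (h1.trans (ih fun v hv => hus v (by simp [hv])) le_rfl).congr ?_ (by simp)
      (hr := by simp) (hl' := by simp)
    simp only [List.flatMap_append, List.flatMap_singleton, List.length_append]
    omega

theorem within_column {us : List (List Γ')} (hus : ∀ u ∈ us, BracketFree u) (h0 : us ≠ []) :
    Within (3 * (columnString us).length)
      (config (some (.column b κ)) i o l ((columnString us).reverse ++ r) c)
      (config (some (.column b κ)) i (columnString (κ.extend us) ++ o) (columnString us ++ l) r
        c) := by
  obtain ⟨us, u, rfl⟩ := (List.eq_nil_or_concat' us).resolve_left h0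
  have h1 : (columnString (us ++ [u])).reverse ++ r =
      .ket :: ((bracket u).reverse ++ ((us.flatMap bracket).reverse ++ .bra :: r)) := by
    simp [columnString, bracket]
  rw [h1]
  refine .mono ?_ (s := 1 + (2 * u.length + 4) + (((us ++ [u]).flatMap bracket).length + 1)) ?_
  · refine ((Within.of_step (step_column_ket ..)).trans (within_newEntry (hus u (by simp)))
      le_rfl).trans ?_ le_rfl
    exact (within_entries (r := r) hus).congr le_rfl
      (by simp [columnString, ColumnKind.extend, bracket])
      (hr := by simp) (hl' := by simp [columnString, bracket])
  · simp only [columnString, length_bracket, List.flatMap_append, List.flatMap_cons,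
      List.flatMap_nil, List.append_nil, List.length_append]
    omega

/-- The entries of the columns have no brackets within their brackets, and the columns are not
empty. -/
def WellFormed (cols : List (List (List Γ'))) : Prop :=
  ∀ us ∈ cols, us ≠ [] ∧ ∀ u ∈ us, BracketFree u

theorem within_columns {cols : List (List (List Γ'))} (hc : WellFormed cols) :
    Within (3 * (cols.flatMap columnString).length + 1)
      (config (some (.column b κ)) i o l ((cols.flatMap columnString).reverse ++ .bra :: r) c)
      (config (some (.check b)) i ((cols.map κ.extend).flatMap columnString ++ o)
        (.bra :: (cols.flatMap columnString ++ l)) r c) := by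
  induction cols using List.reverseRecOn generalizing o l with
  | nil => exact .of_step (step_column_bra ..)
  | append_singleton cols us ih =>
    have h1 := within_column (i := i) (o := o) (l := l)
      (r := (cols.flatMap columnString).reverse ++ .bra :: r) (c := c) (b := b) (κ := κ)
      (hc us (by simp)).2 (hc us (by simp)).1
    refine (h1.trans (ih fun v hv => hc v (by simp [hv])) le_rfl).congr ?_ (by simp)
      (hr := by simp) (hl' := by simp)
    simp only [List.flatMap_append, List.flatMap_singleton, List.length_append]
    omega

theorem within_start {cols : List (List (List Γ'))} (hc : WellFormed cols) :
    Within (3 * (matrixString cols).length)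
      (config (some (.start b κ)) i o [] ((matrixString cols).reverse ++ r) c)
      (config (some (.check b)) i ((cols.map κ.extend).flatMap columnString ++
        if κ = .affine then .ket :: o else o) (matrixString cols) r c) := by
  have h1 : (matrixString cols).reverse ++ r =
      .ket :: ((cols.flatMap columnString).reverse ++ .bra :: r) := by
    simp [matrixString, bracket]
  rw [h1]
  refine (Within.head (step_start ..) (within_columns hc)).mono ?_
  rw [matrixString, length_bracket]
  omega

theorem within_rewind {v : List Γ'} :
    Within (v.length + 1) (config (some (.rewind b κ)) i o v r c)
      (config (some (.start b κ)) i o [] (v.reverse ++ r) c) := by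
  induction v generalizing r with
  | nil => exact .of_step (step_rewind_nil ..)
  | cons s v ih =>
    refine .head (step_rewind_cons ..) ?_
    simpa using ih (r := s :: r)

theorem within_clear {v : List Γ'} :
    Within (v.length + 1) (config (some (.clear b)) i o v r c)
      (config (some (if b then .start false .affine else .finish)) i o [] r c) := by
  induction v with
  | nil => exact .of_step (step_clear_nil ..)
  | cons s v ih => exact .head (step_clear_cons ..) ih

theorem kindOf_ne_affine (s : Γ') : kindOf s ≠ .affine := by
  cases s <;> simp [kindOf]

/-- Each counter symbol costs one step to pop, one more than the length of the matrix to rewind, and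
at most three times that length for the pass. -/
theorem within_check {cols : List (List (List Γ'))} (hc : WellFormed cols) {cs : List Γ'}
    (hcs : c b = cs) :
    Within (cs.length * (4 * (matrixString cols).length + 2) + 1)
      (config (some (.check b)) i o (matrixString cols) r c)
      (config (some (.clear b)) i
        (.bra :: (((cs.map kindOf).reverse.flatMap fun κ => cols.map κ.extend).flatMap columnString
          ++ o)) (matrixString cols) r (Function.update c b [])) := by
  induction cs generalizing o c with
  | nil =>
    have h : Function.update c b [] = c := by simpa only [hcs] using Function.update_eq_self b c
    rw [h]
    exact .mono (.of_step (step_check_nil _ _ _ _ _ _ hcs)) (by simp)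
  | cons s cs ih =>
    have h1 := (Within.head (step_check_cons i o (matrixString cols) r c b s hcs)
      within_rewind).trans (within_start hc) le_rfl
    rw [if_neg (kindOf_ne_affine s)] at h1
    refine (h1.trans (ih (Function.update_self ..)) le_rfl).congr ?_ (by simp) (hc' := by simp)
    rw [List.length_cons]
    linarith

/-- The columns of the extended matrix. -/
def extendAll (kinds : List ColumnKind) (cols : List (List (List Γ'))) : List (List (List Γ')) :=
  kinds.flatMap fun κ => cols.map κ.extend

/-- The kinds appear reversed, with the affine one last, because the output is written from its end.
-/
theorem within_matrix {cols : List (List (List Γ'))} (hc : WellFormed cols) {cs : List Γ'}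
    (hcs : c b = cs) :
    Within ((cs.length + 1) * (4 * (matrixString cols).length + 2))
      (config (some (.start b .affine)) i o [] ((matrixString cols).reverse ++ r) c)
      (config (some (if b then .start false .affine else .finish)) i
        (matrixString (extendAll ((cs.map kindOf).reverse ++ [.affine]) cols) ++ o) [] r
        (Function.update c b [])) := by
  have h := ((within_start (i := i) (o := o) (r := r) (κ := .affine) hc).trans
    (within_check hc hcs) le_rfl).trans within_clear le_rfl
  refine h.congr (by linarith) ?_
  simp [matrixString, extendAll, bracket]

/-- The contents of a counter after `n` symbols have been read. -/
def ticks : ℕ → List Γ'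
  | 0 => []
  | n + 1 => .comma :: .blank :: .blank :: ticks n

theorem length_ticks (n : ℕ) : (ticks n).length = 3 * n := by
  induction n with
  | zero => rfl
  | succ n ih => simp [ticks, ih]; omega

theorem within_load {w : List Γ'} {n : ℕ} :
    Within (w.length + 1) (config (some .load) w o l r fun _ => ticks n)
      (config (some (.start true .affine)) [] o l (w.reverse ++ r)
        fun _ => ticks (n + w.length)) := by
  induction w generalizing r n with
  | nil => exact .of_step (step_load_nil ..)
  | cons s w ih =>
    refine .head (step_load_cons ..) ?_
    refine (ih (n := n + 1)).congr le_rfl rfl (hr' := by simp) (hc' := ?_)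
    rw [List.length_cons, Nat.add_assoc, Nat.add_comm 1]

theorem within_finish {v : List Γ'} :
    Within (v.length + 1) (config (some .finish) i o l v c)
      (config none i (v.reverse ++ o) l [] c) := by
  induction v generalizing o with
  | nil => exact .of_step (step_finish_nil ..)
  | cons s v ih =>
    refine .head (step_finish_cons ..) ?_
    simpa using ih (o := s :: o)

/-- The kinds of columns made out of each column, if the input has length `n`. -/
def kindsList (n : ℕ) : List ColumnKind := ((ticks n).map kindOf).reverse ++ [.affine]

theorem within_extensionMachine {v : List Γ'} {A B : List (List (List Γ'))} (hA : WellFormed A)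
    (hB : WellFormed B) {n : ℕ} (hn : n = (v ++ matrixString A ++ matrixString B).length) :
    Within (40 * (n + 1) ^ 2)
      (config (some .load) (v ++ matrixString A ++ matrixString B) [] [] [] fun _ => [])
      (config none [] (v ++ matrixString (extendAll (kindsList n) A) ++
        matrixString (extendAll (kindsList n) B)) [] [] fun _ => []) := by
  have h1 := within_load (w := v ++ matrixString A ++ matrixString B) (o := []) (l := [])
    (r := []) (n := 0)
  rw [Nat.zero_add, ← hn, List.append_nil, List.reverse_append, List.reverse_append] at h1
  have h2 := (h1.trans (within_matrix hB rfl) le_rfl).trans (within_matrix hA rfl) le_rfl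
  have h3 := h2.trans within_finish le_rfl
  refine h3.congr ?_ (by simp [kindsList]) (hc' := by funext b; cases b <;> simp)
  · simp only [List.length_append] at hn
    simp only [length_ticks, List.length_reverse, Function.update_apply, Bool.false_eq_true,
      if_false]
    nlinarith

/-- The machine, with its alphabets. -/
def extensionComputer : Turing.TM2ComputableAux Γ' Γ' where
  tm := extensionMachine
  inputAlphabet := Equiv.refl _
  outputAlphabet := Equiv.refl _

theorem runsInTime_of_within {t : ℕ} {w w' : List Γ'}
    (h : Within t (config (some .load) w [] [] [] fun _ => [])
      (config none [] w' [] [] fun _ => [])) : RunsInTime extensionComputer w w' t := by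
  obtain ⟨n, hn, h⟩ := h
  have h1 : Turing.initList extensionMachine w =
      config (some .load) w [] [] [] fun _ => [] := by
    refine congrArg (Turing.TM2.Cfg.mk _ _) ?_
    funext k; cases k <;> rfl
  have h2 : Turing.haltList extensionMachine w' = config none [] w' [] [] fun _ => [] := by
    refine congrArg (Turing.TM2.Cfg.mk _ _) ?_
    funext k; cases k <;> rfl
  refine ⟨⟨⟨n, ?_⟩, hn⟩⟩
  have e1 : w.map extensionComputer.inputAlphabet.symm = w := List.map_id _
  have e2 : w'.map extensionComputer.outputAlphabet.symm = w' := List.map_id _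
  rw [e1, e2]
  refine Eq.trans ?_ (h.trans ?_)
  · exact congrArg (fun x => (flip bind machineStep)^[n] (some x)) h1
  · exact congrArg some h2.symm

end Machine

/-! ### Extended matrices -/

section ExtendedMatrix

variable {F : Type*} [Field F] {k n : ℕ}

/-- Splitting off the last coordinate. -/
def snocLinearEquiv (F : Type*) [Field F] (k : ℕ) : (Fin (k + 1) → F) ≃ₗ[F] (Fin k → F) × F where
  toFun v := (fun i => v i.castSucc, v (Fin.last k))
  invFun w := Fin.snoc w.1 w.2
  map_add' _ _ := rfl
  map_smul' _ _ := rfl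
  left_inv v := Fin.snoc_init_self v
  right_inv w := by simp

open scoped Classical in
/-- The column of the given kind that is made from the column `v`. -/
noncomputable def ColumnKind.extendVector (κ : ColumnKind) (v : Fin k → F) : Fin (k + 1) → F :=
  Fin.snoc (if κ = .apex then 0 else v) (if κ = .linear then 0 else 1)

/-- The matrix with the columns of the given kinds, made from all columns of `A`. -/
noncomputable def extendMatrix (kinds : List ColumnKind) (A : Matrix (Fin k) (Fin n) F) :
    Matrix (Fin (k + 1)) (Fin (kinds.length * n)) F :=
  Matrix.of fun i j => (kinds.get j.divNat).extendVector (A.col j.modNat) i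

theorem List.ofFn_get_divNat_modNat {α β : Type*} (l : List α) (φ : α → Fin n → β) :
    List.ofFn (fun j : Fin (l.length * n) => φ (l.get j.divNat) j.modNat) =
      l.flatMap fun a => List.ofFn (φ a) := by
  rw [List.ofFn_mul]
  have h : ∀ (i : Fin l.length) (j : Fin n) (hij : i * n + j < l.length * n),
      (⟨i * n + j, hij⟩ : Fin (l.length * n)) = Fin.mkDivMod i j := fun i j _ =>
    Fin.ext (by simp [Fin.mkDivMod, mul_comm])
  simp only [h, Fin.divNat_mkDivMod, Fin.modNat_mkDivMod]
  rw [List.flatMap_def]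
  conv_rhs => rw [← List.ofFn_get l, List.map_ofFn]
  rfl

theorem extendMatrix_cols (kinds : List ColumnKind) (A : Matrix (Fin k) (Fin n) F) :
    List.ofFn (extendMatrix kinds A).col =
      kinds.flatMap fun κ => List.ofFn fun j => κ.extendVector (A.col j) :=
  List.ofFn_get_divNat_modNat kinds fun κ j => κ.extendVector (A.col j)

theorem map_columns_extendMatrix {kinds : List ColumnKind} (h : kinds.count .affine = 1)
    (A : Matrix (Fin k) (Fin n) F) :
    (columns (extendMatrix kinds A)).map (snocLinearEquiv F k) =
      extendColumns F (kinds.count .linear) (kinds.count .apex * n) (columns A) := by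
  -- The induction needs arbitrary lists of kinds, since a tail may contain no affine kind.
  suffices H : ∀ l : List ColumnKind,
      Multiset.map (snocLinearEquiv F k)
        (l.flatMap fun κ => List.ofFn fun j => κ.extendVector (A.col j) : List _) =
      l.count .affine • (columns A).map (fun a => (a, (1 : F))) +
        l.count .linear • (columns A).map (fun a => (a, (0 : F))) +
          Multiset.replicate (l.count .apex * n) (0, 1) by
    rw [columns, Fin.univ_val_map, extendMatrix_cols, H, h, one_smul, extendColumns]
  have hk : ∀ κ : ColumnKind, Multiset.map (snocLinearEquiv F k)
      (List.ofFn fun j => κ.extendVector (A.col j) : List _) = (columns A).map fun a =>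
        (if κ = .apex then 0 else a, if κ = .linear then (0 : F) else 1) := fun κ => by
    rw [← Fin.univ_val_map, columns, Multiset.map_map, Multiset.map_map]
    refine Multiset.map_congr rfl fun j _ => ?_
    exact (snocLinearEquiv F k).apply_symm_apply (_, _)
  intro l
  induction l with
  | nil => simp
  | cons κ l ih =>
    rw [List.flatMap_cons, ← Multiset.coe_add, Multiset.map_add, ih, hk]
    cases κ
    · simp [add_smul]; abel
    · simp [add_smul]; abel
    · have : (columns A).card = n := by simp [columns]
      simp [this, add_mul, add_comm _ n, Multiset.replicate_add]; abel

/-! ### Row rank -/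

theorem linearIndependent_row_iff {κ ι : Type*} [Fintype κ] [Fintype ι] {A : Matrix κ ι F} :
    LinearIndependent F A.row ↔ ∀ g : κ → F, (∀ v ∈ columns A, ∑ i, g i * v i = 0) → g = 0 := by
  rw [Fintype.linearIndependent_iff]
  refine forall_congr' fun g => imp_congr ?_ funext_iff.symm
  simp only [columns, Multiset.mem_map, forall_exists_index, and_imp, funext_iff,
    Finset.sum_apply, Pi.smul_apply, smul_eq_mul, Pi.zero_apply]
  exact ⟨fun h v j _ hv => funext hv ▸ h j, fun h j => h _ j (Finset.mem_univ_val j) fun _ => rfl⟩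

/-- For a linear relation between the rows, the apex columns kill the last coefficient and the
linear columns reduce the rest to a relation between the rows of `A`. -/
theorem linearIndependent_row_extendMatrix {kinds : List ColumnKind}
    (h : kinds.count .affine = 1) (hl : 0 < kinds.count .linear) (ha : 0 < kinds.count .apex)
    (hn : 0 < n) {A : Matrix (Fin k) (Fin n) F} (hA : LinearIndependent F A.row) :
    LinearIndependent F (extendMatrix kinds A).row := by
  rw [linearIndependent_row_iff] at hA ⊢
  intro g hg
  have key : ∀ w ∈ extendColumns F (kinds.count .linear) (kinds.count .apex * n) (columns A),
      ∑ i : Fin k, g i.castSucc * w.1 i + g (Fin.last k) * w.2 = 0 := by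
    intro w hw
    rw [← map_columns_extendMatrix h] at hw
    obtain ⟨v, hv, rfl⟩ := Multiset.mem_map.1 hw
    rw [← hg v hv, Fin.sum_univ_castSucc]
    rfl
  have hlast : g (Fin.last k) = 0 := by
    simpa using key (0, 1) (Multiset.mem_add.2 (.inr (Multiset.mem_replicate.2
      ⟨(Nat.mul_pos ha hn).ne', rfl⟩)))
  have hinit := hA (fun i => g i.castSucc) fun v hv => by
    simpa using key (v, 0) (Multiset.mem_add.2 (.inl (Multiset.mem_add.2 (.inr
      (Multiset.mem_nsmul.2 ⟨hl.ne', Multiset.mem_map_of_mem _ hv⟩)))))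
  funext i
  refine Fin.lastCases hlast (fun i => ?_) i
  exact congrFun hinit i

theorem permutationCodeEquiv_iff_extendMatrix {kinds : List ColumnKind}
    (h : kinds.count .affine = 1) (hl : n < kinds.count .linear)
    (ha : kinds.count .linear < kinds.count .apex) (hn : 0 < n) (G H : Matrix (Fin k) (Fin n) F) :
    PermutationCodeEquiv G H ↔ LinearCodeEquiv (extendMatrix kinds G) (extendMatrix kinds H) :=
  permutationCodeEquiv_iff_linearCodeEquiv (snocLinearEquiv F k) (map_columns_extendMatrix h G)
    (map_columns_extendMatrix h H)
    (fun v _ => (Multiset.count_le_card _ _).trans_lt (by simpa [columns] using hl))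
    (by rw [Fintype.card_fin, mul_comm]; exact Nat.mul_lt_mul_of_pos_right ha hn)

theorem count_kindsList_affine (n : ℕ) : (kindsList n).count .affine = 1 := by
  simp only [kindsList, List.count_append, List.count_reverse]
  induction n with
  | zero => rfl
  | succ n ih => simpa [ticks, kindOf] using ih

theorem count_kindsList_linear (n : ℕ) : (kindsList n).count .linear = n := by
  simp only [kindsList, List.count_append, List.count_reverse]
  induction n with
  | zero => rfl
  | succ n ih => simpa [ticks, kindOf] using ih

theorem count_kindsList_apex (n : ℕ) : (kindsList n).count .apex = 2 * n := by
  simp only [kindsList, List.count_append, List.count_reverse]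
  induction n with
  | zero => rfl
  | succ n ih => simp [ticks, kindOf] at ih ⊢; omega

end ExtendedMatrix

/-! ### The encoding -/

section Encoding

open Computability

variable (K : FiniteFieldPresentation)

/-- The string within the brackets of a field element. -/
noncomputable def elementBody (a : K.Carrier) : List Γ' :=
  (List.range K.f.natDegree).flatMap
    fun i => encodeBinary ((AdjoinRoot.modByMonicHom K.monic a).coeff i).val

/-- The strings that make up a column. -/
noncomputable def vectorBodies {k : ℕ} (v : Fin k → K.Carrier) : List (List Γ') :=
  List.ofFn fun i => elementBody K (v i)

/-- The strings that make up a matrix. -/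
noncomputable def matrixBodies {k n : ℕ} (A : Matrix (Fin k) (Fin n) K.Carrier) :
    List (List (List Γ')) :=
  (List.ofFn A.col).map (vectorBodies K)

theorem encodeMatrix_eq {k n : ℕ} (A : Matrix (Fin k) (Fin n) K.Carrier) :
    encodeMatrix K A = matrixString (matrixBodies K A) := by
  rw [encodeMatrix, matrixString, bracket, matrixBodies, List.ofFn_eq_map,
    List.map_map, List.flatMap_map]
  congr 2
  refine List.flatMap_congr fun j _ => ?_
  rw [Function.comp_apply, vectorBodies, columnString, bracket, List.ofFn_eq_map,
    List.flatMap_map]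
  rfl

theorem filter_comma_encodeBinary (a : ℕ) :
    (encodeBinary a).filter (fun s => s = .comma) = [.comma] := by
  rw [encodeBinary, List.filter_append, List.filter_eq_nil_iff.2]
  · rfl
  · simp only [List.mem_map]
    rintro s ⟨c, -, rfl⟩
    simp

theorem bracketFree_encodeBinary (a : ℕ) : BracketFree (encodeBinary a) := by
  simp [encodeBinary, BracketFree]

theorem bracketFree_elementBody (a : K.Carrier) : BracketFree (elementBody K a) := by
  constructor <;> simp only [elementBody, List.mem_flatMap, not_exists, not_and]
  · exact fun i _ => (bracketFree_encodeBinary _).1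
  · exact fun i _ => (bracketFree_encodeBinary _).2

/-- Zero is the empty binary string, so erasing all bits while keeping the commas turns any element
into `0`. The machine needs no arithmetic. -/
theorem filter_comma_elementBody (a : K.Carrier) :
    (elementBody K a).filter (fun s => s = .comma) = elementBody K 0 := by
  rw [elementBody, List.filter_flatMap]
  refine List.flatMap_congr fun i _ => ?_
  rw [filter_comma_encodeBinary]
  simp only [map_zero, Polynomial.coeff_zero, ZMod.val_zero]
  rfl

theorem natDegree_pos : 0 < K.f.natDegree := K.irreducible.natDegree_pos

/-- The constant coefficient is written first, and `1` is its own reduced representative because `f`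
has positive degree. -/
theorem elementBody_one : elementBody K 1 = .bit true :: elementBody K 0 := by
  have h1 : AdjoinRoot.modByMonicHom K.monic (1 : K.Carrier) = 1 := by
    rw [← map_one (AdjoinRoot.mk K.f), AdjoinRoot.modByMonicHom_mk,
      Polynomial.modByMonic_eq_self_iff K.monic]
    exact Polynomial.degree_lt_degree (by simpa using natDegree_pos K)
  have : Fact (1 < K.p) := ⟨K.prime.one_lt⟩
  obtain ⟨d, hd⟩ := Nat.exists_eq_succ_of_ne_zero (natDegree_pos K).ne'
  rw [elementBody, elementBody, h1, hd, List.range_succ_eq_map]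
  simp only [List.flatMap_cons, List.flatMap_map, Polynomial.coeff_one, map_zero,
    Polynomial.coeff_zero, ZMod.val_zero, if_true, ZMod.val_one, Nat.succ_ne_zero, if_false]
  rfl

theorem vectorBodies_extendVector (κ : ColumnKind) {k : ℕ} (hk : 0 < k) (v : Fin k → K.Carrier) :
    vectorBodies K (κ.extendVector v) = κ.extend (vectorBodies K v) := by
  obtain ⟨k, rfl⟩ := Nat.exists_eq_succ_of_ne_zero hk.ne'
  have hnew : ∀ a, κ.newBody (elementBody K a) =
      elementBody K (if κ = .linear then 0 else 1) := fun a => by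
    rw [ColumnKind.newBody, filter_comma_elementBody]
    cases κ <;> simp [ColumnKind.bits, elementBody_one]
  have hold : ∀ a, κ.oldBody (elementBody K a) =
      elementBody K (if κ = .apex then 0 else a) := fun a => by
    cases κ
    · simp [ColumnKind.oldBody, ColumnKind.keep]
    · simp [ColumnKind.oldBody, ColumnKind.keep]
    · exact filter_comma_elementBody K a
  have hlast : (vectorBodies K v).getLastD [] = elementBody K (v (Fin.last k)) := by
    rw [vectorBodies, List.ofFn_succ_last]
    simp
  rw [ColumnKind.extend, hlast, hnew, vectorBodies, List.ofFn_succ_last, vectorBodies,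
    List.map_ofFn]
  congr 1
  · refine congrArg _ (funext fun i => ?_)
    rw [Function.comp_apply, hold, ColumnKind.extendVector, Fin.snoc_castSucc]
    cases κ <;> simp
  · rw [ColumnKind.extendVector, Fin.snoc_last]

theorem matrixBodies_extendMatrix (kinds : List ColumnKind) {k n : ℕ} (hk : 0 < k)
    (A : Matrix (Fin k) (Fin n) K.Carrier) :
    matrixBodies K (extendMatrix kinds A) = extendAll kinds (matrixBodies K A) := by
  rw [matrixBodies, extendMatrix_cols, List.map_flatMap, extendAll]
  refine List.flatMap_congr fun κ _ => ?_
  rw [matrixBodies, List.map_map, List.map_ofFn, List.map_ofFn]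
  exact congrArg _ (funext fun j => vectorBodies_extendVector K κ hk _)

theorem wellFormed_matrixBodies {k n : ℕ} (hk : 0 < k) (A : Matrix (Fin k) (Fin n) K.Carrier) :
    WellFormed (matrixBodies K A) := by
  intro us hus
  obtain ⟨v, -, rfl⟩ := List.mem_map.1 hus
  refine ⟨?_, fun u hu => ?_⟩
  · rw [← List.length_pos_iff_ne_nil, vectorBodies, List.length_ofFn]
    exact hk
  · obtain ⟨i, rfl⟩ := (List.mem_ofFn' _ _).1 hu
    exact bracketFree_elementBody K _

/-! ### The length of the encoding -/

theorem length_encodePosNum_le (m : PosNum) : 2 ^ (encodePosNum m).length ≤ 2 * (m : ℕ) := by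
  induction m with
  | one => simp [encodePosNum]
  | bit0 m ih => simp only [encodePosNum, List.length_cons, PosNum.cast_bit0, pow_succ]; omega
  | bit1 m ih => simp only [encodePosNum, List.length_cons, PosNum.cast_bit1, pow_succ]; omega

theorem length_encodeNat_le (a : ℕ) : (encodeNat a).length ≤ Nat.log 2 a + 1 := by
  rcases Nat.eq_zero_or_pos a with rfl | ha
  · exact Nat.zero_le _
  have h : 2 ^ (encodeNat a).length ≤ 2 * a := by
    rw [encodeNat]
    conv_rhs => rw [← Num.to_of_nat a]
    cases hm : (a : Num) with
    | zero =>
      have := Num.to_of_nat a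
      rw [hm] at this
      exact absurd this ha.ne
    | pos m => exact length_encodePosNum_le m
  have := Nat.le_log_of_pow_le Nat.one_lt_two h
  rwa [mul_comm, Nat.log_mul_base Nat.one_lt_two ha.ne'] at this

theorem length_encodeBinary_le (a : ℕ) : (encodeBinary a).length ≤ Nat.log 2 a + 2 := by
  have := length_encodeNat_le a
  simp only [encodeBinary, List.length_append, List.length_map, List.length_singleton]
  omega

theorem length_flatMap_le {α β : Type*} {l : List α} {f : α → List β} {c : ℕ}
    (h : ∀ a ∈ l, (f a).length ≤ c) : (l.flatMap f).length ≤ l.length * c := by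
  induction l with
  | nil => simp
  | cons a l ih =>
    rw [List.flatMap_cons, List.length_append, List.length_cons, add_mul, one_mul, add_comm]
    exact add_le_add (ih fun b hb => h b (List.mem_cons_of_mem _ hb)) (h a (by simp))

/-- Raise `2 ^ log p ≤ p` to the power `deg f`. Both `deg f` and `log p` are positive, so each is
bounded by `log q`. -/
theorem natDegree_mul_log_le : K.f.natDegree * Nat.log 2 K.p ≤ Nat.log 2 K.q := by
  refine Nat.le_log_of_pow_le Nat.one_lt_two ?_
  rw [mul_comm, pow_mul]
  exact Nat.pow_le_pow_left (Nat.pow_log_le_self 2 K.prime.ne_zero) _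

theorem log_p_pos : 0 < Nat.log 2 K.p := Nat.log_pos Nat.one_lt_two K.prime.two_le

theorem natDegree_le_log : K.f.natDegree ≤ Nat.log 2 K.q :=
  (Nat.le_mul_of_pos_right _ (log_p_pos K)).trans (natDegree_mul_log_le K)

theorem log_p_le_log : Nat.log 2 K.p ≤ Nat.log 2 K.q :=
  (Nat.le_mul_of_pos_left _ (natDegree_pos K)).trans (natDegree_mul_log_le K)

theorem length_encodeBinary_val_le (a : ZMod K.p) :
    (encodeBinary a.val).length ≤ Nat.log 2 K.q + 2 :=
  (length_encodeBinary_le _).trans (Nat.add_le_add_right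
    ((Nat.log_mono_right (ZMod.val_lt a).le).trans (log_p_le_log K)) 2)

theorem length_encodeField_le :
    (encodeField K).length ≤ (Nat.log 2 K.q + 2) * (Nat.log 2 K.q + 2) + 2 := by
  have h1 := (length_encodeBinary_le K.p).trans (Nat.add_le_add_right (log_p_le_log K) 2)
  have h2 := length_flatMap_le (l := List.range (K.f.natDegree + 1))
    (f := fun i => encodeBinary (K.f.coeff i).val) fun i _ => length_encodeBinary_val_le K _
  have h3 := Nat.mul_le_mul_right (Nat.log 2 K.q + 2) (natDegree_le_log K)
  simp only [encodeField, List.length_append, List.length_cons, List.length_nil,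
    List.length_range] at h2 ⊢
  nlinarith

theorem length_elementBody_le (a : K.Carrier) :
    (elementBody K a).length ≤ Nat.log 2 K.q * (Nat.log 2 K.q + 2) := by
  refine (length_flatMap_le fun i _ => length_encodeBinary_val_le K _).trans ?_
  rw [List.length_range]
  exact Nat.mul_le_mul_right _ (natDegree_le_log K)

theorem length_encodeMatrix_le {k n : ℕ} (A : Matrix (Fin k) (Fin n) K.Carrier) :
    (encodeMatrix K A).length ≤
      n * (k * (Nat.log 2 K.q * (Nat.log 2 K.q + 2) + 2) + 2) + 2 := by
  rw [encodeMatrix_eq, matrixString, length_bracket]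
  refine Nat.add_le_add_right ((length_flatMap_le
    (c := k * (Nat.log 2 K.q * (Nat.log 2 K.q + 2) + 2) + 2) fun us hus => ?_).trans_eq ?_) 2
  · obtain ⟨v, -, rfl⟩ := List.mem_map.1 hus
    rw [columnString, length_bracket]
    refine Nat.add_le_add_right ((length_flatMap_le
      (c := Nat.log 2 K.q * (Nat.log 2 K.q + 2) + 2) fun u hu => ?_).trans_eq ?_) 2
    · obtain ⟨i, rfl⟩ := (List.mem_ofFn' _ _).1 hu
      rw [length_bracket]
      exact Nat.add_le_add_right (length_elementBody_le K _) 2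
    · rw [vectorBodies, List.length_ofFn]
  · rw [matrixBodies, List.length_map, List.length_ofFn]

variable {K}

/-- The exponent comes from the four factors `n`, `k`, `deg f` and `log p`, each at most `X`. As `X
≥ 1`, additive terms are absorbed: `11` for the field, `9` for each matrix and `1` give `30`. -/
theorem length_encodeInstance_le (x : CodePair K) :
    (encodeInstance K x).length + 1 ≤ 30 * (max x.k x.n * Nat.log 2 K.q) ^ 4 := by
  have hf := length_encodeField_le K
  have hG := length_encodeMatrix_le K x.G
  have hH := length_encodeMatrix_le K x.H
  have hb : 1 ≤ Nat.log 2 K.q := (log_p_pos K).trans_le (log_p_le_log K)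
  have hk : x.k ≤ max x.k x.n := le_max_left _ _
  have hn : x.n ≤ max x.k x.n := le_max_right _ _
  have hN : 1 ≤ max x.k x.n := x.k_pos.trans_le hk
  simp only [encodeInstance, List.length_append]
  generalize Nat.log 2 K.q = b at *
  generalize max x.k x.n = N at *
  set X := N * b
  have hX : 1 ≤ X := Nat.mul_pos hN hb
  have hbX : b ≤ X := Nat.le_mul_of_pos_left _ hN
  have hNX : N ≤ X := Nat.le_mul_of_pos_right _ hb
  have h2 : X ≤ X ^ 2 := Nat.le_self_pow two_ne_zero _
  have h3 : X ^ 2 ≤ X ^ 3 := Nat.pow_le_pow_right hX (by norm_num)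
  have h4 : X ^ 3 ≤ X ^ 4 := Nat.pow_le_pow_right hX (by norm_num)
  have e1 : b * (b + 2) + 2 ≤ 5 * X ^ 2 := by
    have := Nat.mul_le_mul hbX (Nat.add_le_add_right hbX 2)
    nlinarith
  have e2 : (b + 2) * (b + 2) + 2 ≤ 11 * X ^ 2 := by
    have := Nat.mul_le_mul (Nat.add_le_add_right hbX 2) (Nat.add_le_add_right hbX 2)
    nlinarith
  have e3 : x.k * (b * (b + 2) + 2) + 2 ≤ 7 * X ^ 3 := by
    have := Nat.mul_le_mul (hk.trans hNX) e1
    have e : X * (5 * X ^ 2) = 5 * X ^ 3 := by ring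
    omega
  have e4 : x.n * (x.k * (b * (b + 2) + 2) + 2) + 2 ≤ 9 * X ^ 4 := by
    have := Nat.mul_le_mul (hn.trans hNX) e3
    have e : X * (7 * X ^ 3) = 7 * X ^ 4 := by ring
    omega
  omega

/-- Every column contributes its own brackets. This makes the input length a valid `m`: it exceeds
every column multiplicity. -/
theorem lt_length_encodeInstance (x : CodePair K) : x.n < (encodeInstance K x).length := by
  have h : x.n ≤ ((matrixBodies K x.G).flatMap columnString).length := by
    rw [List.length_flatMap]
    refine le_trans ?_ (List.card_nsmul_le_sum _ 1 fun m hm => ?_)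
    · simp [matrixBodies]
    · obtain ⟨us, -, rfl⟩ := List.mem_map.1 hm
      rw [columnString, length_bracket]
      omega
  simp only [encodeInstance, List.length_append, encodeMatrix_eq, matrixString, length_bracket]
  omega

/-! ### The reduction -/

/-- The reduction from Permutation Code Equivalence to Linear Code Equivalence. -/
noncomputable def pceToLce (x : CodePair K) : CodePair K where
  k := x.k + 1
  n := (kindsList (encodeInstance K x).length).length * x.n
  k_pos := Nat.succ_pos _
  n_pos := Nat.mul_pos (by simp [kindsList]) x.n_pos
  G := extendMatrix _ x.G
  H := extendMatrix _ x.H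

theorem pce_iff_lce_pceToLce (x : CodePair K) : x.PCE ↔ (pceToLce x).LCE := by
  have := lt_length_encodeInstance x
  refine permutationCodeEquiv_iff_extendMatrix (count_kindsList_affine _) ?_ ?_ x.n_pos x.G x.H
  · rwa [count_kindsList_linear]
  · rw [count_kindsList_linear, count_kindsList_apex]
    omega

theorem fullRowRank_pceToLce {x : CodePair K} (hx : x.FullRowRank) :
    (pceToLce x).FullRowRank := by
  have := lt_length_encodeInstance x
  have hl : 0 < (kindsList (encodeInstance K x).length).count .linear := by
    rw [count_kindsList_linear]; omega
  have ha : 0 < (kindsList (encodeInstance K x).length).count .apex := by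
    rw [count_kindsList_apex]; omega
  exact ⟨linearIndependent_row_extendMatrix (count_kindsList_affine _) hl ha x.n_pos hx.1,
    linearIndependent_row_extendMatrix (count_kindsList_affine _) hl ha x.n_pos hx.2⟩

theorem runsInTime_pceToLce (x : CodePair K) :
    RunsInTime extensionComputer (encodeInstance K x) (encodeInstance K (pceToLce x))
      (36000 * (max x.k x.n * Nat.log 2 K.q) ^ 8) := by
  refine runsInTime_of_within ?_
  have h := within_extensionMachine (v := encodeField K) (wellFormed_matrixBodies K x.k_pos x.G)
    (wellFormed_matrixBodies K x.k_pos x.H) rfl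
  simp only [← matrixBodies_extendMatrix K _ x.k_pos, ← encodeMatrix_eq] at h
  refine Within.mono h ?_
  have hlen := Nat.pow_le_pow_left (length_encodeInstance_le x) 2
  calc 40 * ((encodeInstance K x).length + 1) ^ 2
      ≤ 40 * (30 * (max x.k x.n * Nat.log 2 K.q) ^ 4) ^ 2 := Nat.mul_le_mul_left _ hlen
    _ = 36000 * (max x.k x.n * Nat.log 2 K.q) ^ 8 := by ring

end Encoding

theorem mainTheorem1 :
    -- a Karp reduction from PCE to LCE over the same field, computed by one machine for all fields
    (∃ (reduction : ∀ K : FiniteFieldPresentation, CodePair K → CodePair K)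
        (T : Turing.TM2ComputableAux Computability.Γ' Computability.Γ') (C d : ℕ),
      ∀ (K : FiniteFieldPresentation) (x : CodePair K),
        (x.PCE ↔ (reduction K x).LCE) ∧
        (x.FullRowRank → (reduction K x).FullRowRank) ∧
        RunsInTime T (encodeInstance K x) (encodeInstance K (reduction K x))
          (C * (max x.k x.n * Nat.log 2 K.q) ^ d)) ∧
    -- correctness of the explicit matrix construction
    (∀ (F : Type*) [Field F] [Finite F] (k n m : ℕ) (G H : Matrix (Fin k) (Fin n) F),
      m = maxColumnMultiplicity G + 1 → m = maxColumnMultiplicity H + 1 →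
        (PermutationCodeEquiv G H ↔
          LinearCodeEquiv (blockExtension m G) (blockExtension m H))) := by
  refine ⟨⟨fun _ => pceToLce, extensionComputer, 36000, 8, fun K x =>
    ⟨pce_iff_lce_pceToLce x, fullRowRank_pceToLce, runsInTime_pceToLce x⟩⟩, ?_⟩
  intro F _ _ k n m G H _ hH
  exact permutationCodeEquiv_iff_blockExtension G H hH
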